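/- There are absolute constants $\delta_0>0$, $\bar C_1>0$ and, for each $q$, a constant $\bar C_2=\bar C_2(q)>0$ depending only on $q$, such that the following holds. Let $m,T,n,r$ be integers, $N=nT$, and let $\mathbf x^{(t,s)}\in\mathbb R^m$ ($t=1,\dots,T$, $s=1,\dots,n$) be nonrandom vectors. For each $(t,s)$ let $X_{(t,s)}\in\mathbb R^{m\times T}$ be the matrix whose $t$-th column is $\mathbf x^{(t,s)}$ and whose other columns are zero. Let $A^*\in\mathbb R^{m\times T}$ with $\operatorname{rank}(A^*)\le r$, and observe $$Y_{(t,s)}=\operatorname{tr}(X_{(t,s)}'A^*)+\xi_{(t,s)},$$ where the $\xi_{(t,s)}$ are i.i.d. $\mathcal N(0,\sigma^2)$, $\sigma>0$. For $A\in\mathbb R^{m\times T}$ with singular values $\sigma_1(A)\ge\sigma_2(A)\ge\cdots$ put $\|A\|_{S_q}=\big(\sum_{j=1}^{\min(m,T)}\sigma_j(A)^q\big)^{1/q}$, and put $|\mathcal L(A)|_2=\big(N^{-1}\sum_{t,s}\operatorname{tr}^2(X_{(t,s)}'A)\big)^{1/2}$ and $\hat d_{2,N}(A,B)=|\mathcal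 L(A-B)|_2$. Assume that all eigenvalues of the Gram matrices $\Psi_t=n^{-1}\sum_{s=1}^n\mathbf x^{(t,s)}(\mathbf x^{(t,s)})'$, $t=1,\dots,T$, are at most $c_1<\infty$. Assume also the Restricted Isometry condition RI$(21r,\nu)$ with constant at most $\delta_0$: $1\le 21r\le\min(m,T)$, $0<\nu<\infty$, and for some $\delta\in(0,1)$ with $\delta\le\delta_0$, $$(1-\delta)\|A\|_{S_2}\le\nu|\mathcal L(A)|_2\le(1+\delta)\|A\|_{S_2}\quad\text{for all }A\in\mathbb R^{m\times T}\text{ of rank at most }21r.$$ Set $\lambda=32\sigma\sqrt{c_1(m+T)/(nT^2)}$ and let $\hat A$ be any minimizer over $A\in\mathbb R^{m\times T}$ of $$\frac1N\sum_{t,s}\big(Y_{(t,s)}-\operatorname{tr}(X_{(t,s)}'A)\big)^2+\lambda\|A\|_{S_1}.$$ Then, with probability at least $1-2\exp\{-(2-\log5)(m+T)\}$, $$\hat d_{2,N}(\hat A,A^*)^2\le\bar C_1c_1\sigma^2r\nu^2\,\frac{m+T}{nT^2}$$ and, simultaneously for all $q\in[1,2]$, $$\|\hat A-A^*\|_{S_q}^q\le\bar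 C_2\,c_1^{q/2}\sigma^qr\nu^{2q}\Big(\frac{m+T}{nT^2}\Big)^{q/2}.$$ -/

import Mathlib

open MeasureTheory ProbabilityTheory

noncomputable section

namespace TraceRegression

/-- The singular values `σ_0(A) ≥ σ_1(A) ≥ ⋯ ≥ 0` of a real `m × T` matrix (indexed from `0`),
with respect to the Euclidean norms. -/
def singularValue {m T : ℕ} (A : Matrix (Fin m) (Fin T) ℝ) (j : ℕ) : ℝ :=
  (Matrix.toEuclideanLin A).singularValues j

/-- The Schatten (quasi-)norm `‖A‖_{S_p} = (∑_{j ≤ min(m,T)} σ_j(A)^p)^{1/p}`, `0 < p < ∞`. -/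
def schattenNorm {m T : ℕ} (p : ℝ) (A : Matrix (Fin m) (Fin T) ℝ) : ℝ :=
  (∑ j ∈ Finset.range (min m T), singularValue A j ^ p) ^ (1 / p)

/-- The sampling operator `A ↦ (tr(X_i' A))_i / √N`, where `N` is the number of masks `X_i`. -/
def samplingOp {m T : ℕ} {ι : Type*} [Fintype ι] (X : ι → Matrix (Fin m) (Fin T) ℝ)
    (A : Matrix (Fin m) (Fin T) ℝ) : EuclideanSpace ℝ ι :=
  WithLp.toLp 2 fun i => ((X i).transpose * A).trace / √(Fintype.card ι : ℝ)

/-- The empirical distance `|L(A - B)|_2`, whose square is the prediction error. -/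
def predDist {m T : ℕ} {ι : Type*} [Fintype ι] (X : ι → Matrix (Fin m) (Fin T) ℝ)
    (A B : Matrix (Fin m) (Fin T) ℝ) : ℝ :=
  ‖samplingOp X (A - B)‖

/-- The Restricted Isometry condition RI(`k`, `ν`) with isometry constant `δ`. -/
structure RestrictedIsometry {m T : ℕ} {ι : Type*} [Fintype ι]
    (X : ι → Matrix (Fin m) (Fin T) ℝ) (k : ℕ) (ν δ : ℝ) : Prop where
  one_le_order : 1 ≤ k
  order_le : k ≤ min m T
  scale_pos : 0 < ν
  const_pos : 0 < δ
  const_lt_one : δ < 1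
  lower : ∀ A : Matrix (Fin m) (Fin T) ℝ, A.rank ≤ k →
    (1 - δ) * schattenNorm 2 A ≤ ν * ‖samplingOp X A‖
  upper : ∀ A : Matrix (Fin m) (Fin T) ℝ, A.rank ≤ k →
    ν * ‖samplingOp X A‖ ≤ (1 + δ) * schattenNorm 2 A

/-- The observations `Y_i = tr(X_i' A) + ξ_i` of the trace regression model. -/
def response {m T : ℕ} {ι : Type*} (X : ι → Matrix (Fin m) (Fin T) ℝ)
    (A : Matrix (Fin m) (Fin T) ℝ) (ξ : ι → ℝ) (i : ι) : ℝ :=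
  ((X i).transpose * A).trace + ξ i

/-- The criterion `N⁻¹ ∑_i (Y_i - tr(X_i' A))² + lam ‖A‖_{S_p}^p`. -/
def schattenCriterion {m T : ℕ} {ι : Type*} [Fintype ι] (X : ι → Matrix (Fin m) (Fin T) ℝ)
    (Y : ι → ℝ) (p lam : ℝ) (A : Matrix (Fin m) (Fin T) ℝ) : ℝ :=
  (Fintype.card ι : ℝ)⁻¹ * ∑ i, (Y i - ((X i).transpose * A).trace) ^ 2
    + lam * schattenNorm p A ^ p

/-- `Ahat` is a Schatten-`p` estimator: a minimizer of the criterion over all matrices. -/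
def IsSchattenEstimator {m T : ℕ} {ι : Type*} [Fintype ι] (X : ι → Matrix (Fin m) (Fin T) ℝ)
    (Y : ι → ℝ) (p lam : ℝ) (Ahat : Matrix (Fin m) (Fin T) ℝ) : Prop :=
  ∀ A : Matrix (Fin m) (Fin T) ℝ,
    schattenCriterion X Y p lam Ahat ≤ schattenCriterion X Y p lam A

/-- The column masks of multi-task learning with `T` tasks and `n` observations per task: the mask
with index `(t, s)` has the predictor `x t s` as its `t`-th column and zeros elsewhere. -/
def taskMask {m T n : ℕ} (x : Fin T → Fin n → Fin m → ℝ) (i : Fin T × Fin n) :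
    Matrix (Fin m) (Fin T) ℝ :=
  Matrix.updateCol 0 i.1 (x i.1 i.2)

/-- The Gram matrix `Ψ_t = n⁻¹ ∑_s x^{(t,s)} (x^{(t,s)})'` of the `t`-th task. -/
def taskGram {m T n : ℕ} (x : Fin T → Fin n → Fin m → ℝ) (t : Fin T) :
    Matrix (Fin m) (Fin m) ℝ :=
  (n : ℝ)⁻¹ • ∑ s : Fin n, Matrix.vecMulVec (x t s) (x t s)

end TraceRegression

end

/-! Let D = Â − A*, ℓ = |𝓛(D)|₂, and let M = N⁻¹ ∑ ξᵢXᵢ be the noise matrix. Only the size of M is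
random: once ‖M‖_op ≤ λ/4, the rest is deterministic and holds for every minimizer.

Optimality of Â and trace duality give ℓ² + λ‖Â‖₁ ≤ (λ/2)‖D‖₁ + λ‖A*‖₁. Split D = D' + D'' with rank
D' ≤ 2r and the row and column spaces of D'' orthogonal to those of A*. The nuclear norm is additive
on A* and D'', so ℓ² + (λ/2)‖D''‖₁ ≤ (3/2)λ‖D'‖₁; in particular D lies in the cone ‖D''‖₁ ≤ 3‖D'‖₁
(`basic_inequality`, `exists_decomposition`, `schattenNorm_one_add_le`).

On this cone restricted isometry controls all of D. Keep the leading 19r singular components B₁ of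
D''. Cutting the remainder R into blocks of length 19r bounds both ‖R‖₂ and ν|𝓛(R)|₂ by about
‖D''‖₁/√(19r), which is less than ‖D' + B₁‖₂ since 3√(2/19) < 1 (`exists_truncation`). As rank(D' +
B₁) ≤ 21r, the main part dominates, so ‖D' + B₁‖₂ ≲ νℓ. The quadratic inequality then bounds ℓ,
hence ‖D‖₁ and ‖D‖₂ (`estimator_bounds`); interpolation gives every q in [1,2].

The bound on ‖M‖_op is a union bound over half-nets of the two unit balls: each u'Mv is Gaussian
with variance at most σ²c₁/(nT²), and there are at most 5^(m+T) pairs (`exists_noise_event`). -/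

namespace TraceRegression

/-! ### Frobenius geometry and the singular value decomposition -/

variable {m T n : ℕ}

/-- The vectorization of a matrix; its Euclidean norm is the Frobenius norm. -/
noncomputable def vecL : Matrix (Fin m) (Fin T) ℝ →ₗ[ℝ] EuclideanSpace ℝ (Fin m × Fin T) where
  toFun A := WithLp.toLp 2 fun p => A p.1 p.2
  map_add' A B := by ext; simp
  map_smul' c A := by ext; simp

/-- The rank-one matrix `u v'`. -/
noncomputable def outer (u : EuclideanSpace ℝ (Fin m)) (v : EuclideanSpace ℝ (Fin T)) :
    Matrix (Fin m) (Fin T) ℝ :=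
  Matrix.vecMulVec u.ofLp v.ofLp

theorem inner_vecL (A B : Matrix (Fin m) (Fin T) ℝ) :
    inner ℝ (vecL A) (vecL B) = (A.transpose * B).trace := by
  simp only [vecL, LinearMap.coe_mk, AddHom.coe_mk, PiLp.inner_apply, Matrix.trace, Matrix.diag,
    Matrix.mul_apply, Matrix.transpose_apply, Fintype.sum_prod_type]
  rw [Finset.sum_comm]
  simp [mul_comm]

theorem inner_vecL_outer (A : Matrix (Fin m) (Fin T) ℝ) (u : EuclideanSpace ℝ (Fin m))
    (v : EuclideanSpace ℝ (Fin T)) :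
    inner ℝ (vecL A) (vecL (outer u v)) = inner ℝ u (Matrix.toEuclideanLin A v) := by
  simp only [vecL, outer, LinearMap.coe_mk, AddHom.coe_mk, PiLp.inner_apply, Fintype.sum_prod_type,
    Matrix.vecMulVec_apply, Matrix.ofLp_toLpLin, Matrix.toLin'_apply, Matrix.mulVec, dotProduct]
  refine Finset.sum_congr rfl fun i _ => ?_
  simp only [RCLike.inner_apply, conj_trivial, Finset.sum_mul]
  exact Finset.sum_congr rfl fun j _ => by ring

theorem toEuclideanLin_outer (u : EuclideanSpace ℝ (Fin m)) (v w : EuclideanSpace ℝ (Fin T)) :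
    Matrix.toEuclideanLin (outer u v) w = inner ℝ v w • u := by
  ext i
  simp only [outer, Matrix.ofLp_toLpLin, Matrix.toLin'_apply, Matrix.mulVec, dotProduct,
    Matrix.vecMulVec_apply, PiLp.smul_apply, PiLp.inner_apply, smul_eq_mul, RCLike.inner_apply,
    conj_trivial, Finset.sum_mul]
  exact Finset.sum_congr rfl fun j _ => by ring

theorem inner_vecL_outer_outer (u u' : EuclideanSpace ℝ (Fin m)) (v v' : EuclideanSpace ℝ (Fin T)) :
    inner ℝ (vecL (outer u v)) (vecL (outer u' v')) = inner ℝ u' u * inner ℝ v v' := by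
  rw [inner_vecL_outer, toEuclideanLin_outer, inner_smul_right, mul_comm]

theorem transpose_outer (u : EuclideanSpace ℝ (Fin m)) (v : EuclideanSpace ℝ (Fin T)) :
    (outer u v).transpose = outer v u := by
  simp [outer, Matrix.transpose_vecMulVec]

theorem rank_outer_le_one (u : EuclideanSpace ℝ (Fin m)) (v : EuclideanSpace ℝ (Fin T)) :
    (outer u v).rank ≤ 1 := Matrix.rank_vecMulVec_le _ _

theorem finrank_range_toEuclideanLin (A : Matrix (Fin m) (Fin T) ℝ) :
    Module.finrank ℝ (Matrix.toEuclideanLin A).range = A.rank := by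
  rw [Matrix.rank_eq_finrank_range_toLin A (EuclideanSpace.basisFun (Fin m) ℝ).toBasis
    (EuclideanSpace.basisFun (Fin T) ℝ).toBasis, Matrix.toEuclideanLin_eq_toLin_orthonormal]

theorem singularValue_pos_iff (A : Matrix (Fin m) (Fin T) ℝ) (j : ℕ) :
    0 < singularValue A j ↔ j < A.rank := by
  rw [singularValue, LinearMap.singularValues_pos_iff_lt_finrank_range,
    finrank_range_toEuclideanLin]

theorem singularValue_nonneg (A : Matrix (Fin m) (Fin T) ℝ) (j : ℕ) : 0 ≤ singularValue A j :=
  LinearMap.singularValues_nonneg _ _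

theorem singularValue_antitone (A : Matrix (Fin m) (Fin T) ℝ) : Antitone (singularValue A) :=
  LinearMap.singularValues_antitone _

theorem singularValue_eq_zero (A : Matrix (Fin m) (Fin T) ℝ) {j : ℕ} (hj : A.rank ≤ j) :
    singularValue A j = 0 :=
  le_antisymm (not_lt.1 fun h => absurd ((singularValue_pos_iff A j).1 h) (not_lt.2 hj))
    (singularValue_nonneg A j)

/-- Singular value decomposition. -/
theorem exists_svd (A : Matrix (Fin m) (Fin T) ℝ) :
    ∃ (u : Fin A.rank → EuclideanSpace ℝ (Fin m)) (v : Fin A.rank → EuclideanSpace ℝ (Fin T)),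
      Orthonormal ℝ u ∧ Orthonormal ℝ v ∧
      A = ∑ i : Fin A.rank, singularValue A i • outer (u i) (v i) := by
  have hT : Module.finrank ℝ (EuclideanSpace ℝ (Fin T)) = T := by simp
  have hrank : A.rank ≤ T := A.rank_le_width
  set f := Matrix.toEuclideanLin A with hf
  have hsym := f.isSymmetric_adjoint_comp_self
  -- The right singular vectors are eigenvectors of f*f. Their images under f are orthogonal with
  -- lengths σ_j, so normalizing those with σ_j ≠ 0 gives the left singular vectors.
  set b := hsym.eigenvectorBasis hT with hb
  have hfb (i j : Fin T) : inner ℝ (f (b i)) (f (b j))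
      = if i = j then singularValue A j ^ 2 else 0 := by
    have h1 : inner ℝ (f (b i)) (f (b j)) = inner ℝ (b i) ((f.adjoint ∘ₗ f) (b j)) := by
      rw [LinearMap.comp_apply, LinearMap.adjoint_inner_right]
    rw [h1, hb, hsym.apply_eigenvectorBasis, inner_smul_right, ← hb,
      orthonormal_iff_ite.1 b.orthonormal, singularValue, ← hf, f.sq_singularValues_fin hT]
    simp
  let v : Fin A.rank → EuclideanSpace ℝ (Fin T) := fun i => b (Fin.castLE hrank i)
  let u : Fin A.rank → EuclideanSpace ℝ (Fin m) := fun i => (singularValue A i)⁻¹ • f (v i)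
  have hpos (i : Fin A.rank) : singularValue A i ≠ 0 :=
    ((singularValue_pos_iff A i).2 i.2).ne'
  refine ⟨u, v, ?_, b.orthonormal.comp _ (Fin.castLE_injective hrank), ?_⟩
  · rw [orthonormal_iff_ite]
    intro i j
    simp only [u, v, inner_smul_left, inner_smul_right, hfb, Fin.castLE_inj]
    split_ifs with h
    · subst h
      have := hpos i
      simp
      field_simp
    · simp
  · apply Matrix.toEuclideanLin.injective
    refine b.toBasis.ext fun j => ?_
    simp only [OrthonormalBasis.coe_toBasis, map_sum, map_smul, LinearMap.sum_apply,
      LinearMap.smul_apply, toEuclideanLin_outer, ← hf, u, v]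
    simp only [orthonormal_iff_ite.1 b.orthonormal]
    by_cases hj : (j : ℕ) < A.rank
    · rw [Finset.sum_eq_single ⟨j, hj⟩]
      · have h := hpos ⟨j, hj⟩
        simp only [Fin.castLE_mk, Fin.eta, if_true, one_mul, smul_smul]
        simp only at h
        rw [mul_inv_cancel₀ h, one_smul]
      · intro i _ hi
        have : Fin.castLE hrank i ≠ j := by
          rintro rfl
          exact hi (by ext; simp)
        simp [this]
      · simp
    -- Past the rank, f(b_j) has norm σ_j = 0, so both sides vanish on b_j.
    · rw [Finset.sum_eq_zero]
      · rw [← inner_self_eq_zero (𝕜 := ℝ), hfb, if_pos rfl, singularValue_eq_zero A (not_lt.1 hj)]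
        simp
      · intro i _
        have : Fin.castLE hrank i ≠ j := by
          rintro rfl
          exact hj (by simp)
        simp [this]

theorem sum_singularValue_rpow (A : Matrix (Fin m) (Fin T) ℝ) {p : ℝ} (hp : p ≠ 0) :
    ∑ j ∈ Finset.range (min m T), singularValue A j ^ p
      = ∑ i : Fin A.rank, singularValue A i ^ p := by
  rw [Fin.sum_univ_eq_sum_range (fun j => singularValue A j ^ p)]
  symm
  refine Finset.sum_subset ?_ fun j _ hj => ?_
  · exact Finset.range_subset_range.2 (le_min A.rank_le_height A.rank_le_width)
  · rw [singularValue_eq_zero A (by simpa using hj), Real.zero_rpow hp]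

theorem schattenNorm_one (A : Matrix (Fin m) (Fin T) ℝ) :
    schattenNorm 1 A = ∑ i : Fin A.rank, singularValue A i := by
  rw [schattenNorm, sum_singularValue_rpow A one_ne_zero]
  simp

theorem schattenNorm_one_nonneg (A : Matrix (Fin m) (Fin T) ℝ) : 0 ≤ schattenNorm 1 A := by
  rw [schattenNorm_one]
  exact Finset.sum_nonneg fun i _ => singularValue_nonneg A i

theorem orthonormal_vecL_outer {ι : Type*} {u : ι → EuclideanSpace ℝ (Fin m)}
    {v : ι → EuclideanSpace ℝ (Fin T)} (hu : Orthonormal ℝ u) (hv : Orthonormal ℝ v) :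
    Orthonormal ℝ fun i => vecL (outer (u i) (v i)) := by
  classical
  rw [orthonormal_iff_ite] at *
  intro i j
  rw [inner_vecL_outer_outer, hu, hv]
  by_cases h : i = j
  · simp [h]
  · simp [h, Ne.symm h]

theorem sum_sq_singularValue (A : Matrix (Fin m) (Fin T) ℝ) :
    ∑ i : Fin A.rank, singularValue A i ^ 2 = ‖vecL A‖ ^ 2 := by
  obtain ⟨u, v, hu, hv, hA⟩ := exists_svd A
  have h : vecL A = ∑ i : Fin A.rank, singularValue A i • vecL (outer (u i) (v i)) := by
    conv_lhs => rw [hA]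
    simp
  rw [h, ← real_inner_self_eq_norm_sq, (orthonormal_vecL_outer hu hv).inner_sum]
  simp [pow_two]

theorem schattenNorm_two (A : Matrix (Fin m) (Fin T) ℝ) : schattenNorm 2 A = ‖vecL A‖ := by
  rw [schattenNorm, sum_singularValue_rpow A two_ne_zero]
  simp only [Real.rpow_two]
  rw [sum_sq_singularValue, ← Real.sqrt_eq_rpow, Real.sqrt_sq (norm_nonneg _)]

theorem schattenNorm_one_le_of_rank_le (A : Matrix (Fin m) (Fin T) ℝ) {k : ℕ} (hk : A.rank ≤ k) :
    schattenNorm 1 A ≤ √k * ‖vecL A‖ := by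
  rw [schattenNorm_one]
  apply Real.le_sqrt_of_sq_le _ |>.trans
  · exact (Real.sqrt_mul_self (by positivity)).le
  calc (∑ i : Fin A.rank, singularValue A i) ^ 2
      ≤ (A.rank : ℝ) * ∑ i : Fin A.rank, singularValue A i ^ 2 := by
        simpa using sq_sum_le_card_mul_sum_sq (s := Finset.univ)
          (f := fun i : Fin A.rank => singularValue A i)
    _ ≤ k * ‖vecL A‖ ^ 2 := by
        rw [sum_sq_singularValue]
        gcongr
    _ = √k * ‖vecL A‖ * (√k * ‖vecL A‖) := by
        rw [mul_mul_mul_comm, Real.mul_self_sqrt (Nat.cast_nonneg k), pow_two]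

/-! ### Duality and additivity of the nuclear norm -/

/-- Duality between the nuclear and the operator norm. -/
theorem inner_vecL_le_mul_schattenNorm_one (A B : Matrix (Fin m) (Fin T) ℝ) {c : ℝ}
    (hB : ∀ u v, |inner ℝ u (Matrix.toEuclideanLin B v)| ≤ c * ‖u‖ * ‖v‖) :
    |inner ℝ (vecL B) (vecL A)| ≤ c * schattenNorm 1 A := by
  obtain ⟨u, v, hu, hv, hA⟩ := exists_svd A
  have h : vecL A = ∑ i : Fin A.rank, singularValue A i • vecL (outer (u i) (v i)) := by
    conv_lhs => rw [hA]
    simp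
  rw [h, inner_sum, schattenNorm_one, Finset.mul_sum]
  refine (Finset.abs_sum_le_sum_abs _ _).trans (Finset.sum_le_sum fun i _ => ?_)
  rw [inner_smul_right, inner_vecL_outer, abs_mul, abs_of_nonneg (singularValue_nonneg A i),
    mul_comm]
  have := hB (u i) (v i)
  rw [hu.1, hv.1, mul_one, mul_one] at this
  gcongr
  exact singularValue_nonneg A i

/-- Cauchy–Schwarz followed by Bessel's inequality for each family. Such partial isometries are the
test matrices for the nuclear norm. -/
theorem abs_inner_sum_outer_le {ι : Type*} [Fintype ι] {u : ι → EuclideanSpace ℝ (Fin m)}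
    {v : ι → EuclideanSpace ℝ (Fin T)} (hu : Orthonormal ℝ u) (hv : Orthonormal ℝ v)
    (x : EuclideanSpace ℝ (Fin m)) (y : EuclideanSpace ℝ (Fin T)) :
    |inner ℝ x (Matrix.toEuclideanLin (∑ i, outer (u i) (v i)) y)| ≤ 1 * ‖x‖ * ‖y‖ := by
  have h : inner ℝ x (Matrix.toEuclideanLin (∑ i, outer (u i) (v i)) y)
      = ∑ i, inner ℝ (u i) x * inner ℝ (v i) y := by
    simp only [map_sum, LinearMap.sum_apply, toEuclideanLin_outer, inner_sum, inner_smul_right]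
    exact Finset.sum_congr rfl fun i _ => by rw [mul_comm, real_inner_comm]
  have hx := hu.sum_inner_products_le (s := Finset.univ) x
  have hy := hv.sum_inner_products_le (s := Finset.univ) y
  simp only [Real.norm_eq_abs, sq_abs] at hx hy
  rw [h, one_mul]
  refine abs_le_of_sq_le_sq ?_ (by positivity)
  calc _ ≤ _ := Finset.sum_mul_sq_le_sq_mul_sq _ _ _
    _ ≤ ‖x‖ ^ 2 * ‖y‖ ^ 2 := by gcongr
    _ = _ := by ring

theorem inner_toEuclideanLin_left (A : Matrix (Fin m) (Fin T) ℝ)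
    (x : EuclideanSpace ℝ (Fin T)) (y : EuclideanSpace ℝ (Fin m)) :
    inner ℝ (Matrix.toEuclideanLin A x) y = inner ℝ x (Matrix.toEuclideanLin A.transpose y) := by
  have h : A.transpose = A.conjTranspose := by simp
  rw [h, Matrix.toEuclideanLin_conjTranspose_eq_adjoint, LinearMap.adjoint_inner_right]

theorem toEuclideanLin_mul {k : ℕ} (A : Matrix (Fin m) (Fin k) ℝ) (B : Matrix (Fin k) (Fin T) ℝ)
    (x : EuclideanSpace ℝ (Fin T)) :
    Matrix.toEuclideanLin (A * B) x = Matrix.toEuclideanLin A (Matrix.toEuclideanLin B x) := by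
  simp [Matrix.toLpLin_apply]

theorem toEuclideanLin_right_singular {A : Matrix (Fin m) (Fin T) ℝ}
    {ι : Type*} [Fintype ι] {s : ι → ℝ} {u : ι → EuclideanSpace ℝ (Fin m)}
    {v : ι → EuclideanSpace ℝ (Fin T)} (hv : Orthonormal ℝ v)
    (hA : A = ∑ i, s i • outer (u i) (v i)) (j : ι) :
    Matrix.toEuclideanLin A (v j) = s j • u j := by
  classical
  simp only [hA, map_sum, map_smul, LinearMap.sum_apply, LinearMap.smul_apply,
    toEuclideanLin_outer, orthonormal_iff_ite.1 hv]
  simp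

theorem toEuclideanLin_left_singular {A : Matrix (Fin m) (Fin T) ℝ}
    {ι : Type*} [Fintype ι] {s : ι → ℝ} {u : ι → EuclideanSpace ℝ (Fin m)}
    {v : ι → EuclideanSpace ℝ (Fin T)} (hu : Orthonormal ℝ u)
    (hA : A = ∑ i, s i • outer (u i) (v i)) (j : ι) :
    Matrix.toEuclideanLin A.transpose (u j) = s j • v j := by
  refine toEuclideanLin_right_singular hu (u := v) ?_ j
  rw [hA, Matrix.transpose_sum]
  simp [transpose_outer]

/-- Additivity of the nuclear norm on matrices with orthogonal row and column spaces, with the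
triangle inequality built in. -/
theorem schattenNorm_one_add_le {A B : Matrix (Fin m) (Fin T) ℝ} (h₁ : A.transpose * B = 0)
    (h₂ : A * B.transpose = 0) (D : Matrix (Fin m) (Fin T) ℝ) :
    schattenNorm 1 A + schattenNorm 1 B ≤ schattenNorm 1 (A + B + D) + schattenNorm 1 D := by
  classical
  obtain ⟨u, v, hu, hv, hA⟩ := exists_svd A
  obtain ⟨w, z, hw, hz, hB⟩ := exists_svd B
  have hpA (i : Fin A.rank) : singularValue A i ≠ 0 := ((singularValue_pos_iff A i).2 i.2).ne'
  have hpB (i : Fin B.rank) : singularValue B i ≠ 0 := ((singularValue_pos_iff B i).2 i.2).ne'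
  -- The hypothesis A'B = 0 makes the column spaces orthogonal, and AB' = 0 the row spaces, so the
  -- two singular systems merge into one.
  have huw (i j) : inner ℝ (u i) (w j) = 0 := by
    have : inner ℝ (singularValue A i • u i) (singularValue B j • w j) = 0 := by
      rw [← toEuclideanLin_right_singular hv hA, ← toEuclideanLin_right_singular hz hB,
        inner_toEuclideanLin_left, ← toEuclideanLin_mul, h₁]
      simp
    simpa [inner_smul_left, inner_smul_right, hpA, hpB] using this
  have hvz (i j) : inner ℝ (v i) (z j) = 0 := by
    have : inner ℝ (singularValue A i • v i) (singularValue B j • z j) = 0 := by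
      rw [← toEuclideanLin_left_singular hu hA, ← toEuclideanLin_left_singular hw hB,
        inner_toEuclideanLin_left, ← toEuclideanLin_mul, Matrix.transpose_transpose, h₂]
      simp
    simpa [inner_smul_left, inner_smul_right, hpA, hpB] using this
  have hwu (i j) : inner ℝ (w i) (u j) = 0 := by rw [real_inner_comm, huw]
  have hzv (i j) : inner ℝ (z i) (v j) = 0 := by rw [real_inner_comm, hvz]
  have huw' : Orthonormal ℝ (Sum.elim u w) := by
    rw [orthonormal_iff_ite] at *
    rintro (i | i) (j | j) <;> simp [hu, hw, huw, hwu]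
  have hvz' : Orthonormal ℝ (Sum.elim v z) := by
    rw [orthonormal_iff_ite] at *
    rintro (i | i) (j | j) <;> simp [hv, hz, hvz, hzv]
  -- S has operator norm at most 1 and attains both nuclear norms at once: ⟨S, A⟩ = ‖A‖₁ and ⟨S, B⟩
  -- = ‖B‖₁. Duality against A + B + D and against D finishes.
  set S := ∑ i, outer (Sum.elim u w i) (Sum.elim v z i) with hS
  have hSb := abs_inner_sum_outer_le huw' hvz'
  have hO := orthonormal_iff_ite.1 (orthonormal_vecL_outer huw' hvz')
  have hSA : inner ℝ (vecL S) (vecL A) = schattenNorm 1 A := by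
    have h : vecL A = ∑ i : Fin A.rank, singularValue A i • vecL (outer (u i) (v i)) := by
      conv_lhs => rw [hA]
      simp
    rw [h, hS, schattenNorm_one, map_sum]
    simp only [inner_sum, sum_inner, inner_smul_right]
    refine Finset.sum_congr rfl fun i _ => ?_
    have := fun k => hO k (Sum.inl i)
    simp only [Sum.elim_inl] at this
    simp [this]
  have hSB : inner ℝ (vecL S) (vecL B) = schattenNorm 1 B := by
    have h : vecL B = ∑ i : Fin B.rank, singularValue B i • vecL (outer (w i) (z i)) := by
      conv_lhs => rw [hB]
      simp
    rw [h, hS, schattenNorm_one, map_sum]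
    simp only [inner_sum, sum_inner, inner_smul_right]
    refine Finset.sum_congr rfl fun i _ => ?_
    have := fun k => hO k (Sum.inr i)
    simp only [Sum.elim_inr] at this
    simp [this]
  have h3 := inner_vecL_le_mul_schattenNorm_one (A + B + D) S hSb
  have h4 := inner_vecL_le_mul_schattenNorm_one D S hSb
  rw [map_add, map_add, inner_add_right, inner_add_right, hSA, hSB] at h3
  rw [abs_le] at h3 h4
  linarith [h3.2, h4.1]

theorem schattenNorm_one_add_le_add (A B : Matrix (Fin m) (Fin T) ℝ) :
    schattenNorm 1 (A + B) ≤ schattenNorm 1 A + schattenNorm 1 B := by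
  have h := schattenNorm_one_add_le (A := A + B) (B := 0) (by simp) (by simp) (-B)
  have h0 := schattenNorm_one_nonneg (0 : Matrix (Fin m) (Fin T) ℝ)
  have hneg : schattenNorm 1 (-B) ≤ schattenNorm 1 B := by
    have h := schattenNorm_one_add_le (A := -B) (B := 0) (by simp) (by simp) B
    have hz : schattenNorm 1 (0 : Matrix (Fin m) (Fin T) ℝ) = 0 := by
      rw [schattenNorm_one]
      simp [singularValue]
    simp only [add_zero, neg_add_cancel] at h
    linarith
  simp only [add_zero, add_neg_cancel_right] at h
  linarith

/-! ### Truncation of singular values by blocks, and projections -/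

/-- Shifting by one block: as τ decreases, K times its first value on a block is at most its sum
over the preceding block. Hence each block norm is charged to the block before it, at the price
1/√K. -/
theorem norm_sum_Ico_le_of_blocks {V : Type*} [SeminormedAddCommGroup V] (a : ℕ → V) {τ : ℕ → ℝ}
    (hτ : Antitone τ) {K : ℕ} (hK : 0 < K) {c : ℝ} (hc : 0 ≤ c)
    (h : ∀ j, ‖∑ i ∈ Finset.Ico (j * K) ((j + 1) * K), a i‖ ≤ c * (√K * τ (j * K))) (J : ℕ) :
    ‖∑ i ∈ Finset.Ico K ((J + 1) * K), a i‖ ≤ c / √K * ∑ i ∈ Finset.range (J * K), τ i := by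
  have hK' : (0 : ℝ) < K := by exact_mod_cast hK
  induction J with
  | zero => simp
  | succ J ih =>
    have e1 : ∑ i ∈ Finset.Ico K ((J + 1 + 1) * K), a i
        = ∑ i ∈ Finset.Ico K ((J + 1) * K), a i
          + ∑ i ∈ Finset.Ico ((J + 1) * K) ((J + 1 + 1) * K), a i :=
      (Finset.sum_Ico_consecutive _ (Nat.le_mul_of_pos_left K (by omega))
        (Nat.mul_le_mul_right K (by omega))).symm
    have e2 : ∑ i ∈ Finset.range ((J + 1) * K), τ i
        = ∑ i ∈ Finset.range (J * K), τ i + ∑ i ∈ Finset.Ico (J * K) ((J + 1) * K), τ i :=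
      (Finset.sum_range_add_sum_Ico _ (Nat.mul_le_mul_right K (by omega))).symm
    have hb : K * τ ((J + 1) * K) ≤ ∑ i ∈ Finset.Ico (J * K) ((J + 1) * K), τ i := by
      have := Finset.card_nsmul_le_sum (Finset.Ico (J * K) ((J + 1) * K)) τ (τ ((J + 1) * K))
        fun i hi => hτ (Finset.mem_Ico.1 hi).2.le
      simpa [Nat.add_mul] using this
    have e3 : c * (√K * τ ((J + 1) * K)) = c / √K * (K * τ ((J + 1) * K)) := by
      have hs : √(K : ℝ) ≠ 0 := (Real.sqrt_pos.2 hK').ne'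
      field_simp
      rw [Real.sq_sqrt hK'.le]
      ring
    rw [e1, e2, mul_add]
    refine (norm_add_le _ _).trans (add_le_add ih ((h (J + 1)).trans ?_))
    rw [e3]
    gcongr

theorem rank_add_le (A B : Matrix (Fin m) (Fin T) ℝ) : (A + B).rank ≤ A.rank + B.rank := by
  have h : (A + B).mulVecLin.range ≤ A.mulVecLin.range ⊔ B.mulVecLin.range := by
    rintro _ ⟨x, rfl⟩
    rw [Matrix.mulVecLin_apply, Matrix.add_mulVec]
    exact Submodule.add_mem_sup ⟨x, rfl⟩ ⟨x, rfl⟩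
  exact (Submodule.finrank_mono h).trans (Submodule.finrank_add_le_finrank_add_finrank _ _)

theorem rank_sum_le {ι : Type*} (s : Finset ι) (A : ι → Matrix (Fin m) (Fin T) ℝ)
    (hA : ∀ i ∈ s, (A i).rank ≤ 1) : (∑ i ∈ s, A i).rank ≤ s.card := by
  classical
  induction s using Finset.induction_on with
  | empty => simp
  | insert i s hi ih =>
    rw [Finset.sum_insert hi, Finset.card_insert_of_notMem hi, add_comm s.card]
    exact (rank_add_le _ _).trans (add_le_add (hA i (by simp))
      (ih fun j hj => hA j (by simp [hj])))

theorem rank_smul_le (c : ℝ) (A : Matrix (Fin m) (Fin T) ℝ) : (c • A).rank ≤ A.rank := by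
  have : c • A = (c • (1 : Matrix (Fin m) (Fin m) ℝ)) * A := by simp
  rw [this]
  exact Matrix.rank_mul_le_right _ _

theorem mul_outer {k : ℕ} (P : Matrix (Fin k) (Fin m) ℝ) (u : EuclideanSpace ℝ (Fin m))
    (v : EuclideanSpace ℝ (Fin T)) : P * outer u v = outer (Matrix.toEuclideanLin P u) v := by
  simp [outer, Matrix.mul_vecMulVec]

theorem outer_mul {k : ℕ} (Q : Matrix (Fin T) (Fin k) ℝ) (u : EuclideanSpace ℝ (Fin m))
    (v : EuclideanSpace ℝ (Fin T)) :
    outer u v * Q = outer u (Matrix.toEuclideanLin Q.transpose v) := by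
  rw [← Matrix.transpose_inj, Matrix.transpose_mul, transpose_outer, mul_outer, transpose_outer]

theorem outer_zero_left (v : EuclideanSpace ℝ (Fin T)) :
    outer (0 : EuclideanSpace ℝ (Fin m)) v = 0 := by
  simp [outer]

theorem outer_zero_right (u : EuclideanSpace ℝ (Fin m)) :
    outer u (0 : EuclideanSpace ℝ (Fin T)) = 0 := by
  rw [← transpose_outer, outer_zero_left, Matrix.transpose_zero]

/-- The orthogonal projection onto the column space. -/
theorem exists_column_projection (A : Matrix (Fin m) (Fin T) ℝ) :
    ∃ P : Matrix (Fin m) (Fin m) ℝ, P.transpose = P ∧ P * P = P ∧ P * A = A ∧ P.rank ≤ A.rank := by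
  obtain ⟨u, v, hu, hv, hA⟩ := exists_svd A
  have hP : (∑ i, outer (u i) (u i)) = ∑ i, (1 : ℝ) • outer (u i) (u i) := by simp
  have hPu (i) : Matrix.toEuclideanLin (∑ i, outer (u i) (u i)) (u i) = u i := by
    simpa using toEuclideanLin_right_singular hu hP i
  refine ⟨∑ i, outer (u i) (u i), ?_, ?_, ?_, ?_⟩
  · simp [Matrix.transpose_sum, transpose_outer]
  · rw [Finset.mul_sum]
    exact Finset.sum_congr rfl fun i _ => by rw [mul_outer, hPu]
  · have h : (∑ i, outer (u i) (u i)) * (∑ i : Fin A.rank, singularValue A i • outer (u i) (v i))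
        = ∑ i : Fin A.rank, singularValue A i • outer (u i) (v i) := by
      rw [Matrix.mul_sum]
      exact Finset.sum_congr rfl fun i _ => by rw [Matrix.mul_smul, mul_outer, hPu]
    rwa [← hA] at h
  · simpa using rank_sum_le Finset.univ (fun i => outer (u i) (u i))
      fun i _ => rank_outer_le_one _ _

theorem exists_row_projection (A : Matrix (Fin m) (Fin T) ℝ) :
    ∃ Q : Matrix (Fin T) (Fin T) ℝ, Q.transpose = Q ∧ Q * Q = Q ∧ A * Q = A ∧ Q.rank ≤ A.rank := by
  obtain ⟨Q, h1, h2, h3, h4⟩ := exists_column_projection A.transpose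
  refine ⟨Q, h1, h2, ?_, by simpa [Matrix.rank_transpose] using h4⟩
  rw [← Matrix.transpose_inj, Matrix.transpose_mul, h1, h3]

/-- Singular value decomposition, indexed by all natural numbers. -/
theorem exists_seq_svd (B : Matrix (Fin m) (Fin T) ℝ) :
    ∃ E : ℕ → Matrix (Fin m) (Fin T) ℝ, (∀ i, (E i).rank ≤ 1) ∧
      (∀ i j, i ≠ j → inner ℝ (vecL (E i)) (vecL (E j)) = 0) ∧ (∀ i, ‖vecL (E i)‖ ≤ 1) ∧
      (∀ P : Matrix (Fin m) (Fin m) ℝ, P * B = 0 → ∀ i, P * E i = 0) ∧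
      (∀ Q : Matrix (Fin T) (Fin T) ℝ, B * Q = 0 → ∀ i, E i * Q = 0) ∧
      ∀ k, B.rank ≤ k → B = ∑ i ∈ Finset.range k, singularValue B i • E i := by
  obtain ⟨u, v, hu, hv, hB⟩ := exists_svd B
  have hp (i : Fin B.rank) : singularValue B i ≠ 0 := ((singularValue_pos_iff B i).2 i.2).ne'
  have hO := orthonormal_vecL_outer hu hv
  -- Padding by zero past the rank lets blocks overrun the rank; this is why the norms are only
  -- bounded by 1.
  refine ⟨fun i => if h : i < B.rank then outer (u ⟨i, h⟩) (v ⟨i, h⟩) else 0,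
    fun i => ?_, fun i j hij => ?_, fun i => ?_, fun P hP i => ?_, fun Q hQ i => ?_,
    fun k hk => ?_⟩
  · dsimp only
    split_ifs
    · exact rank_outer_le_one _ _
    · simp
  · dsimp only
    split_ifs with h h'
    · exact hO.2 (by simpa using hij)
    all_goals simp
  · dsimp only
    split_ifs with h
    · exact (hO.1 ⟨i, h⟩).le
    · simp
  · dsimp only
    split_ifs with h
    · have h0 : singularValue B i • Matrix.toEuclideanLin P (u ⟨i, h⟩) = 0 := by
        rw [← map_smul, ← toEuclideanLin_right_singular hv hB ⟨i, h⟩, ← toEuclideanLin_mul, hP]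
        simp
      rw [mul_outer, (smul_eq_zero.1 h0).resolve_left (hp ⟨i, h⟩), outer_zero_left]
    · simp
  · dsimp only
    split_ifs with h
    · have h0 : singularValue B i • Matrix.toEuclideanLin Q.transpose (v ⟨i, h⟩) = 0 := by
        rw [← map_smul, ← toEuclideanLin_left_singular hu hB ⟨i, h⟩, ← toEuclideanLin_mul,
          ← Matrix.transpose_mul, hQ]
        simp
      rw [outer_mul, (smul_eq_zero.1 h0).resolve_left (hp ⟨i, h⟩), outer_zero_right]
    · simp
  · rw [← Finset.sum_subset (Finset.range_subset_range.2 hk), Finset.sum_range]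
    · conv_lhs => rw [hB]
      simp
    · intro i _ hi
      rw [singularValue_eq_zero B (by simpa using hi), zero_smul]

theorem norm_vecL_block_le {E : ℕ → Matrix (Fin m) (Fin T) ℝ}
    (hE : ∀ i j, i ≠ j → inner ℝ (vecL (E i)) (vecL (E j)) = 0) (hE1 : ∀ i, ‖vecL (E i)‖ ≤ 1)
    {τ : ℕ → ℝ} (hτ : Antitone τ) (hτ0 : ∀ i, 0 ≤ τ i) (a b : ℕ) :
    ‖vecL (∑ i ∈ Finset.Ico a b, τ i • E i)‖ ≤ √((b - a : ℕ) : ℝ) * τ a := by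
  have h : ‖vecL (∑ i ∈ Finset.Ico a b, τ i • E i)‖ ^ 2
      = ∑ i ∈ Finset.Ico a b, τ i ^ 2 * ‖vecL (E i)‖ ^ 2 := by
    rw [← real_inner_self_eq_norm_sq, map_sum, sum_inner]
    refine Finset.sum_congr rfl fun i hi => ?_
    rw [inner_sum, Finset.sum_eq_single i]
    · rw [map_smul, inner_smul_left, inner_smul_right, real_inner_self_eq_norm_sq]
      simp only [conj_trivial]
      ring
    · intro j _ hj
      rw [map_smul, map_smul, inner_smul_left, inner_smul_right, hE i j hj.symm]
      simp
    · exact fun h => absurd hi h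
  refine abs_le_of_sq_le_sq' ?_ (mul_nonneg (Real.sqrt_nonneg _) (hτ0 a)) |>.2
  rw [h, mul_pow, Real.sq_sqrt (Nat.cast_nonneg _)]
  have : ∀ i ∈ Finset.Ico a b, τ i ^ 2 * ‖vecL (E i)‖ ^ 2 ≤ τ a ^ 2 := fun i hi => by
    have h1 : τ i ^ 2 ≤ τ a ^ 2 := by
      have := hτ (Finset.mem_Ico.1 hi).1
      have := hτ0 i
      gcongr
    have h2 : ‖vecL (E i)‖ ^ 2 ≤ 1 := pow_le_one₀ (norm_nonneg _) (hE1 i)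
    calc _ ≤ τ a ^ 2 * 1 := by gcongr
      _ = _ := mul_one _
  simpa using Finset.sum_le_card_nsmul _ _ _ this

/-- Splitting off the leading `K` singular components; the remainder is controlled by the nuclear
norm under any linear map that is bounded on matrices of rank at most `K`. -/
theorem exists_truncation (B : Matrix (Fin m) (Fin T) ℝ) {K : ℕ} (hK : 0 < K) :
    ∃ B₁ R : Matrix (Fin m) (Fin T) ℝ, B = B₁ + R ∧ B₁.rank ≤ K ∧
      (∀ P : Matrix (Fin m) (Fin m) ℝ, P * B = 0 → P * B₁ = 0) ∧
      (∀ Q : Matrix (Fin T) (Fin T) ℝ, B * Q = 0 → B₁ * Q = 0) ∧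
      ∀ (V : Type) [SeminormedAddCommGroup V] [NormedSpace ℝ V]
        (L : Matrix (Fin m) (Fin T) ℝ →ₗ[ℝ] V) (c : ℝ), 0 ≤ c →
        (∀ A, A.rank ≤ K → ‖L A‖ ≤ c * ‖vecL A‖) → ‖L R‖ ≤ c / √K * schattenNorm 1 B := by
  obtain ⟨E, hE1, hE2, hE3, hE4, hE5, hE6⟩ := exists_seq_svd B
  have hr (a b : ℕ) : (∑ i ∈ Finset.Ico a b, singularValue B i • E i).rank ≤ b - a := by
    simpa using rank_sum_le (Finset.Ico a b) (fun i => singularValue B i • E i)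
      fun i _ => (rank_smul_le _ _).trans (hE1 i)
  -- Any J with JK ≥ rank B would do: J + 1 blocks of length K then exhaust the singular components.
  set J := B.rank
  have hJ : B.rank ≤ J * K := Nat.le_mul_of_pos_right _ hK
  have hJ1 : B.rank ≤ (J + 1) * K := hJ.trans (Nat.mul_le_mul_right K (by omega))
  refine ⟨∑ i ∈ Finset.Ico 0 K, singularValue B i • E i,
    ∑ i ∈ Finset.Ico K ((J + 1) * K), singularValue B i • E i, ?_, by simpa using hr 0 K,
    fun P hP => ?_, fun Q hQ => ?_, fun V _ _ L c hc hL => ?_⟩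
  · rw [Finset.sum_Ico_consecutive _ (Nat.zero_le _) (Nat.le_mul_of_pos_left K (by omega)),
      ← Finset.range_eq_Ico]
    exact hE6 _ hJ1
  · rw [Matrix.mul_sum]
    exact Finset.sum_eq_zero fun i _ => by rw [Matrix.mul_smul, hE4 P hP, smul_zero]
  · rw [Matrix.sum_mul]
    exact Finset.sum_eq_zero fun i _ => by rw [Matrix.smul_mul, hE5 Q hQ, smul_zero]
  · have hn : schattenNorm 1 B = ∑ i ∈ Finset.range (J * K), singularValue B i := by
      rw [schattenNorm_one, Fin.sum_univ_eq_sum_range (fun j => singularValue B j)]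
      refine Finset.sum_subset (Finset.range_subset_range.2 hJ) fun j _ hj => ?_
      exact singularValue_eq_zero B (by simpa using hj)
    rw [hn, map_sum]
    refine norm_sum_Ico_le_of_blocks (fun i => L (singularValue B i • E i))
      (singularValue_antitone B) hK hc (fun j => ?_) J
    have hs : (j + 1) * K - j * K = K := by simp [Nat.add_mul]
    rw [← map_sum]
    refine (hL _ ((hr _ _).trans hs.le)).trans ?_
    gcongr
    have := norm_vecL_block_le hE2 hE3 (singularValue_antitone B) (singularValue_nonneg B)
      (j * K) ((j + 1) * K)
    rwa [hs] at this

/-! ### The deterministic oracle inequality -/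

/-- The sampling operator as a linear map. -/
noncomputable def samplingLinear {ι : Type*} [Fintype ι] (X : ι → Matrix (Fin m) (Fin T) ℝ) :
    Matrix (Fin m) (Fin T) ℝ →ₗ[ℝ] EuclideanSpace ℝ ι where
  toFun := samplingOp X
  map_add' A B := by
    ext i
    simp [samplingOp, Matrix.mul_add, add_div]
  map_smul' c A := by
    ext i
    simp [samplingOp, mul_div_assoc]

theorem norm_samplingOp_sq {ι : Type*} [Fintype ι] (X : ι → Matrix (Fin m) (Fin T) ℝ)
    (A : Matrix (Fin m) (Fin T) ℝ) :
    ‖samplingOp X A‖ ^ 2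
      = (Fintype.card ι : ℝ)⁻¹ * ∑ i, ((X i).transpose * A).trace ^ 2 := by
  rw [EuclideanSpace.norm_sq_eq, Finset.mul_sum]
  refine Finset.sum_congr rfl fun i _ => ?_
  simp only [samplingOp, Real.norm_eq_abs, sq_abs, div_pow, Real.sq_sqrt (Nat.cast_nonneg _)]
  ring

/-- The noise matrix `N⁻¹ ∑ ξ_i X_i`. -/
noncomputable def noiseMatrix {ι : Type*} [Fintype ι] (X : ι → Matrix (Fin m) (Fin T) ℝ)
    (ξ : ι → ℝ) : Matrix (Fin m) (Fin T) ℝ :=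
  (Fintype.card ι : ℝ)⁻¹ • ∑ i, ξ i • X i

theorem inner_vecL_noiseMatrix {ι : Type*} [Fintype ι] (X : ι → Matrix (Fin m) (Fin T) ℝ)
    (ξ : ι → ℝ) (A : Matrix (Fin m) (Fin T) ℝ) :
    inner ℝ (vecL (noiseMatrix X ξ)) (vecL A)
      = (Fintype.card ι : ℝ)⁻¹ * ∑ i, ξ i * ((X i).transpose * A).trace := by
  simp [noiseMatrix, inner_smul_left, sum_inner, inner_vecL]

/-- The basic inequality for the penalized least squares estimator. -/
theorem basic_inequality {ι : Type*} [Fintype ι] {X : ι → Matrix (Fin m) (Fin T) ℝ}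
    {Astar Ahat : Matrix (Fin m) (Fin T) ℝ} {ξ : ι → ℝ} {lam : ℝ}
    (h : IsSchattenEstimator X (response X Astar ξ) 1 lam Ahat) :
    predDist X Ahat Astar ^ 2 + lam * schattenNorm 1 Ahat
      ≤ 2 * inner ℝ (vecL (noiseMatrix X ξ)) (vecL (Ahat - Astar))
        + lam * schattenNorm 1 Astar := by
  have h := h Astar
  simp only [schattenCriterion, response, Real.rpow_one] at h
  rw [predDist, norm_samplingOp_sq, inner_vecL_noiseMatrix]
  have e : ∀ i, (((X i).transpose * Astar).trace + ξ i - ((X i).transpose * Ahat).trace) ^ 2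
      = ξ i ^ 2 - 2 * (ξ i * ((X i).transpose * (Ahat - Astar)).trace)
        + ((X i).transpose * (Ahat - Astar)).trace ^ 2 := fun i => by
    rw [Matrix.mul_sub, Matrix.trace_sub]
    ring
  simp only [e, add_sub_cancel_left, Finset.sum_add_distrib, Finset.sum_sub_distrib,
    ← Finset.mul_sum] at h
  nlinarith [h]

/-- Decomposition of a matrix with respect to the column and row spaces of `A`. -/
theorem exists_decomposition (A D : Matrix (Fin m) (Fin T) ℝ) :
    ∃ (D' D'' : Matrix (Fin m) (Fin T) ℝ) (P : Matrix (Fin m) (Fin m) ℝ)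
      (Q : Matrix (Fin T) (Fin T) ℝ), D = D' + D'' ∧ D'.rank ≤ 2 * A.rank ∧
      A.transpose * D'' = 0 ∧ A * D''.transpose = 0 ∧ P * D'' = 0 ∧ D'' * Q = 0 ∧
      ∀ B : Matrix (Fin m) (Fin T) ℝ, P * B = 0 → B * Q = 0 →
        inner ℝ (vecL D') (vecL B) = 0 := by
  obtain ⟨P, hPt, hPP, hPA, hPr⟩ := exists_column_projection A
  obtain ⟨Q, hQt, hQQ, hAQ, hQr⟩ := exists_row_projection A
  have hAP : A.transpose * P = A.transpose := by
    rw [← Matrix.transpose_inj, Matrix.transpose_mul, hPt, Matrix.transpose_transpose, hPA]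
  -- P and Q project onto the column and row spaces of A. Each summand of D' has a factor P or Q,
  -- hence rank at most rank A, and is orthogonal to every B killed by P on the left and Q on the
  -- right.
  refine ⟨P * D + (1 - P) * D * Q, (1 - P) * D * (1 - Q), P, Q, ?_, ?_, ?_, ?_, ?_, ?_,
    fun B hB hB' => ?_⟩
  · simp only [Matrix.mul_sub, Matrix.sub_mul, Matrix.mul_one, Matrix.one_mul]
    abel
  · rw [two_mul]
    exact (rank_add_le _ _).trans (add_le_add ((Matrix.rank_mul_le_left _ _).trans hPr)
      ((Matrix.rank_mul_le_right _ _).trans hQr))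
  · rw [← Matrix.mul_assoc, ← Matrix.mul_assoc, Matrix.mul_sub A.transpose, hAP]
    simp
  · rw [Matrix.transpose_mul, ← Matrix.mul_assoc, Matrix.transpose_sub, Matrix.mul_sub, hQt]
    simp [hAQ]
  · rw [← Matrix.mul_assoc, ← Matrix.mul_assoc, Matrix.mul_sub P, hPP]
    simp
  · rw [Matrix.mul_assoc, Matrix.sub_mul 1 Q, hQQ]
    simp
  · rw [inner_vecL, Matrix.transpose_add, Matrix.add_mul, Matrix.trace_add, Matrix.transpose_mul,
      Matrix.transpose_mul, hPt, hQt, Matrix.mul_assoc, hB, Matrix.mul_assoc Q, Matrix.trace_mul_comm Q,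
      Matrix.mul_assoc, hB']
    simp

/-- The hypotheses chain to ℓ² ≤ (3/2)λ · s · 200νℓ, and one factor ℓ cancels. -/
theorem le_of_sq_le_of_le {lam s ν ℓ a b d : ℝ} (hlam : 0 < lam) (hs : 0 < s) (hν : 0 < ν)
    (hb : 0 ≤ b) (hkey : ℓ ^ 2 + lam / 2 * b ≤ 3 / 2 * lam * a) (ha : a ≤ s * d)
    (hd : d ≤ 200 * (ν * ℓ)) : ℓ ≤ 300 * (lam * s * ν) := by
  have hb0 : 0 ≤ lam / 2 * b := by positivity
  have h2 : a ≤ s * (200 * (ν * ℓ)) := ha.trans (by gcongr)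
  have h3 := mul_le_mul_of_nonneg_left h2 (by positivity : 0 ≤ 3 / 2 * lam)
  by_contra! hlt
  have hpos : 0 < ℓ := lt_of_le_of_lt (by positivity) hlt
  have := mul_lt_mul_of_pos_right hlt hpos
  linarith [this, h3, hkey, sq ℓ]

set_option maxHeartbeats 800000 in
/-- The deterministic oracle inequality. -/
theorem estimator_bounds {ι : Type} [Fintype ι] {X : ι → Matrix (Fin m) (Fin T) ℝ}
    {Astar Ahat : Matrix (Fin m) (Fin T) ℝ} {ξ : ι → ℝ} {lam ν δ : ℝ} {r : ℕ}
    (hr : Astar.rank ≤ r) (hRI : RestrictedIsometry X (21 * r) ν δ) (hδ : δ ≤ 1 / 100)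
    (hlam : 0 < lam) (h : IsSchattenEstimator X (response X Astar ξ) 1 lam Ahat)
    (hM : ∀ u v, |inner ℝ u (Matrix.toEuclideanLin (noiseMatrix X ξ) v)|
      ≤ lam / 4 * ‖u‖ * ‖v‖) :
    predDist X Ahat Astar ^ 2 ≤ 180000 * lam ^ 2 * r * ν ^ 2 ∧
    schattenNorm 1 (Ahat - Astar) ≤ 480000 * (lam * ν ^ 2) * r ∧
    ‖vecL (Ahat - Astar)‖ ^ 2 ≤ 28800000000 * (lam * ν ^ 2) ^ 2 * r := by
  have hr0 : 0 < r := by have := hRI.one_le_order; omega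
  have hν := hRI.scale_pos
  have hδ0 := hRI.const_pos
  have hrR : (0 : ℝ) < r := by exact_mod_cast hr0
  obtain ⟨D', D'', P, Q, hD, hD'r, ho1, ho2, hPD, hDQ, horth⟩ :=
    exists_decomposition Astar (Ahat - Astar)
  -- With K = kr the argument needs 3√(2/k) < 1, that is k > 18; k = 19 is the least integer choice,
  -- and 19r + 2r = 21r is the order of the isometry condition.
  obtain ⟨B₁, R, hB, hB₁r, hPB, hBQ, hR⟩ := exists_truncation D'' (K := 19 * r) (by omega)
  have hbasic := basic_inequality h
  have hdual := (abs_le.1 (inner_vecL_le_mul_schattenNorm_one (Ahat - Astar) _ hM)).2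
  have htri : schattenNorm 1 (Ahat - Astar) ≤ schattenNorm 1 D' + schattenNorm 1 D'' := by
    rw [hD]; exact schattenNorm_one_add_le_add _ _
  have hadd : schattenNorm 1 Astar + schattenNorm 1 D''
      ≤ schattenNorm 1 Ahat + schattenNorm 1 D' := by
    have := schattenNorm_one_add_le ho1 ho2 D'
    rwa [add_assoc, add_comm D'' D', ← hD, add_sub_cancel] at this
  have hD'2 : schattenNorm 1 D' ≤ √(2 * r) * ‖vecL D'‖ := by
    simpa using schattenNorm_one_le_of_rank_le D' (k := 2 * r) (hD'r.trans (by omega))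
  set ℓ := predDist X Ahat Astar with hℓ
  set a := schattenNorm 1 D'
  set b := schattenNorm 1 D''
  have hkey : ℓ ^ 2 + lam / 2 * b ≤ 3 / 2 * lam * a := by
    have h1 : lam / 2 * schattenNorm 1 (Ahat - Astar) ≤ lam / 2 * (a + b) := by gcongr
    have h2 := mul_le_mul_of_nonneg_left hadd hlam.le
    linarith
  have hb3 : b ≤ 3 * a := by nlinarith [sq_nonneg ℓ]
  set W := ‖vecL (D' + B₁)‖ with hW
  -- B₁ inherits from D'' the annihilation by P and Q, so D' and B₁ are orthogonal and Pythagoras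
  -- applies.
  have hD'W : ‖vecL D'‖ ≤ W := by
    have h0 := horth B₁ (hPB P hPD) (hBQ Q hDQ)
    have := norm_add_sq_real (vecL D') (vecL B₁)
    rw [h0, ← map_add] at this
    refine abs_le_of_sq_le_sq' ?_ (norm_nonneg _) |>.2
    nlinarith [sq_nonneg ‖vecL B₁‖]
  set s := √(2 * (r : ℝ)) with hs
  have hs0 : 0 < s := Real.sqrt_pos.2 (by positivity)
  have hs2 : s ^ 2 = 2 * r := Real.sq_sqrt (by positivity)
  have hc19 : √((19 * r : ℕ) : ℝ) ≠ 0 := (Real.sqrt_pos.2 (by positivity)).ne'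
  -- The cone condition gives b ≤ 3√(2r) W, and 3√(2/19) ≈ 0.9733.
  have hratio : b / √((19 * r : ℕ) : ℝ) ≤ 0.9752 * W := by
    have h1 : b ≤ 3 * (s * W) := hb3.trans (by
      have := mul_le_mul_of_nonneg_left hD'W hs0.le
      linarith)
    have h2 : 3 * s ≤ 0.9752 * √((19 * r : ℕ) : ℝ) := by
      refine abs_le_of_sq_le_sq' ?_ (by positivity) |>.2
      rw [mul_pow, mul_pow, hs2, Real.sq_sqrt (by positivity)]
      push_cast
      nlinarith
    rw [div_le_iff₀ (by positivity)]
    nlinarith [mul_le_mul_of_nonneg_right h2 (norm_nonneg (vecL (D' + B₁)))]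
  have hvR : ‖vecL R‖ ≤ 0.9752 * W := by
    have := hR _ vecL 1 zero_le_one fun A _ => by simp
    rw [one_div, inv_mul_eq_div] at this
    exact this.trans hratio
  have hLR : ν * ‖samplingOp X R‖ ≤ (1 + δ) * (0.9752 * W) := by
    have h1 := hR _ (samplingLinear X) ((1 + δ) / ν) (by positivity) fun A hA => by
      have := hRI.upper A (hA.trans (by omega))
      rw [schattenNorm_two] at this
      rw [div_mul_eq_mul_div, le_div_iff₀ hν, mul_comm]
      exact this
    have h2 : ν * ((1 + δ) / ν / √((19 * r : ℕ) : ℝ) * b)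
        = (1 + δ) * (b / √((19 * r : ℕ) : ℝ)) := by
      field_simp
    calc ν * ‖samplingOp X R‖ ≤ ν * ((1 + δ) / ν / √((19 * r : ℕ) : ℝ) * b) := by
          gcongr
          exact h1
      _ ≤ _ := by
          rw [h2]
          gcongr
  have hlow : (1 - δ) * W ≤ ν * ‖samplingOp X (D' + B₁)‖ := by
    have := hRI.lower (D' + B₁) ((rank_add_le _ _).trans (by omega))
    rwa [schattenNorm_two] at this
  have hDsum : Ahat - Astar = (D' + B₁) + R := by rw [hD, hB, add_assoc]
  have hℓ1 : ‖samplingOp X (D' + B₁)‖ ≤ ℓ + ‖samplingOp X R‖ := by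
    have e : samplingLinear X (D' + B₁) = samplingLinear X (Ahat - Astar) - samplingLinear X R := by
      rw [hDsum, map_add _ (D' + B₁) R, add_sub_cancel_right]
    have := norm_sub_le (samplingLinear X (Ahat - Astar)) (samplingLinear X R)
    rw [← e] at this
    exact this
  have hW0 : 0 ≤ W := norm_nonneg _
  have hℓ0 : 0 ≤ ℓ := norm_nonneg _
  -- For δ ≤ 1/100, (1 − δ) − 0.9752(1 + δ) ≥ 0.005048 > 1/200. This margin fixes δ₀ and the factor
  -- 200.
  have hWℓ : W ≤ 200 * (ν * ℓ) := by
    have h1 := mul_le_mul_of_nonneg_left hℓ1 hν.le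
    have h2 : δ * W ≤ 1 / 100 * W := by gcongr
    nlinarith
  have hℓb := le_of_sq_le_of_le hlam hs0 hν (schattenNorm_one_nonneg _) hkey hD'2
    (hD'W.trans hWℓ)
  have hWb : W ≤ 60000 * (s * (lam * ν ^ 2)) := by
    calc W ≤ 200 * (ν * ℓ) := hWℓ
      _ ≤ 200 * (ν * (300 * (lam * s * ν))) := by gcongr
      _ = _ := by ring
  refine ⟨?_, ?_, ?_⟩
  · calc ℓ ^ 2 ≤ (300 * (lam * s * ν)) ^ 2 := by gcongr
      _ = 90000 * lam ^ 2 * s ^ 2 * ν ^ 2 := by ring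
      _ = _ := by rw [hs2]; ring
  · calc schattenNorm 1 (Ahat - Astar) ≤ 4 * a := by linarith
      _ ≤ 4 * (s * (60000 * (s * (lam * ν ^ 2)))) := by
          have : a ≤ s * (60000 * (s * (lam * ν ^ 2))) := hD'2.trans (by
            gcongr
            exact hD'W.trans hWb)
          linarith
      _ = 240000 * (lam * ν ^ 2) * s ^ 2 := by ring
      _ = _ := by rw [hs2]; ring
  · have h1 : ‖vecL (Ahat - Astar)‖ ≤ 120000 * (s * (lam * ν ^ 2)) := by
      rw [hDsum, map_add]
      refine (norm_add_le _ _).trans ?_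
      linarith
    calc _ ≤ (120000 * (s * (lam * ν ^ 2))) ^ 2 := by gcongr
      _ = 14400000000 * (lam * ν ^ 2) ^ 2 * s ^ 2 := by ring
      _ = _ := by rw [hs2]; ring

/-! ### Nets and the operator norm -/

/-- A `1/2`-net of the unit ball with at most `5 ^ d` elements. -/
theorem exists_half_net (E : Type*) [NormedAddCommGroup E] [NormedSpace ℝ E]
    [FiniteDimensional ℝ E] :
    ∃ s : Finset E, s.card ≤ 5 ^ Module.finrank ℝ E ∧ (∀ c ∈ s, ‖c‖ ≤ 1) ∧
      ∀ x : E, ‖x‖ ≤ 1 → ∃ c ∈ s, ‖x - c‖ ≤ 1 / 2 := by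
  classical
  -- A 1-separated subset of the ball of radius 2 has at most 5^d points. One of maximal cardinality
  -- is a 1-net of that ball, and halving it gives the net sought.
  let p : ℕ → Prop := fun k => ∃ s : Finset E, s.card = k ∧ (∀ c ∈ s, ‖c‖ ≤ 2) ∧
    ∀ c ∈ s, ∀ d ∈ s, c ≠ d → 1 ≤ ‖c - d‖
  have hle (k) (hk : p k) : k ≤ 5 ^ Module.finrank ℝ E := by
    obtain ⟨s, rfl, h1, h2⟩ := hk
    exact Besicovitch.card_le_of_separated s h1 h2
  have h0 : p 0 := ⟨∅, by simp⟩
  obtain ⟨s, hs, h1, h2⟩ : p (Nat.findGreatest p (5 ^ Module.finrank ℝ E)) :=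
    Nat.findGreatest_spec (Nat.zero_le _) h0
  have hmax (k) (hk : p k) : k ≤ s.card := hs ▸ Nat.le_findGreatest (hle k hk) hk
  refine ⟨s.image fun c => (2⁻¹ : ℝ) • c, Finset.card_image_le.trans (hs ▸ Nat.findGreatest_le _),
    ?_, fun x hx => ?_⟩
  · simp only [Finset.mem_image, forall_exists_index, and_imp, forall_apply_eq_imp_iff₂]
    intro c hc
    have := h1 c hc
    rw [norm_smul]
    norm_num
    linarith
  · by_contra! hcon
    have hfar (c) (hc : c ∈ s) : 1 ≤ ‖(2 : ℝ) • x - c‖ := by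
      have := hcon _ (Finset.mem_image_of_mem _ hc)
      have e : (2 : ℝ) • x - c = (2 : ℝ) • (x - (2⁻¹ : ℝ) • c) := by
        rw [smul_sub, smul_smul]; norm_num
      rw [e, norm_smul]
      norm_num
      linarith
    have hnot : (2 : ℝ) • x ∉ s := fun h => by
      have := hfar _ h
      simp at this
      linarith
    have := hmax (s.card + 1) ⟨insert ((2 : ℝ) • x) s, Finset.card_insert_of_notMem hnot, ?_, ?_⟩
    · omega
    · intro c hc
      rcases Finset.mem_insert.1 hc with rfl | hc
      · rw [norm_smul]
        norm_num
        linarith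
      · exact h1 c hc
    · intro c hc d hd hcd
      rcases Finset.mem_insert.1 hc with rfl | hc <;> rcases Finset.mem_insert.1 hd with rfl | hd
      · exact absurd rfl hcd
      · exact hfar d hd
      · rw [norm_sub_rev]
        exact hfar c hc
      · exact h2 c hc d hd hcd

/-- Replacing a unit vector by a net point costs at most ‖f‖/2, so ‖f‖ ≤ K + ‖f‖/2, which is
absorbed on the left. -/
theorem opNorm_le_of_half_net {E F : Type*} [NormedAddCommGroup E] [NormedSpace ℝ E]
    [NormedAddCommGroup F] [NormedSpace ℝ F] (f : E →L[ℝ] F) {s : Finset E}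
    (hs : ∀ x : E, ‖x‖ ≤ 1 → ∃ c ∈ s, ‖x - c‖ ≤ 1 / 2) {K : ℝ} (hK : 0 ≤ K)
    (h : ∀ c ∈ s, ‖f c‖ ≤ K) : ‖f‖ ≤ 2 * K := by
  have : ‖f‖ ≤ K + ‖f‖ / 2 := by
    refine f.opNorm_le_of_unit_norm (by positivity) fun x hx => ?_
    obtain ⟨c, hc, hxc⟩ := hs x hx.le
    calc ‖f x‖ = ‖f c + f (x - c)‖ := by rw [← map_add, add_sub_cancel]
      _ ≤ ‖f c‖ + ‖f (x - c)‖ := norm_add_le _ _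
      _ ≤ K + ‖f‖ * (1 / 2) := by
          gcongr
          · exact h c hc
          · exact (f.le_opNorm _).trans (by gcongr)
      _ = _ := by ring
  linarith

theorem abs_inner_le_of_half_nets (A : Matrix (Fin m) (Fin T) ℝ)
    {s : Finset (EuclideanSpace ℝ (Fin m))} {t : Finset (EuclideanSpace ℝ (Fin T))}
    (hs : ∀ x : EuclideanSpace ℝ (Fin m), ‖x‖ ≤ 1 → ∃ c ∈ s, ‖x - c‖ ≤ 1 / 2)
    (ht : ∀ x : EuclideanSpace ℝ (Fin T), ‖x‖ ≤ 1 → ∃ c ∈ t, ‖x - c‖ ≤ 1 / 2) {K : ℝ}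
    (hK : 0 ≤ K) (h : ∀ u ∈ s, ∀ v ∈ t, |inner ℝ u (Matrix.toEuclideanLin A v)| ≤ K)
    (u : EuclideanSpace ℝ (Fin m)) (v : EuclideanSpace ℝ (Fin T)) :
    |inner ℝ u (Matrix.toEuclideanLin A v)| ≤ 4 * K * ‖u‖ * ‖v‖ := by
  have h1 : ‖(Matrix.toEuclideanLin A).toContinuousLinearMap‖ ≤ 2 * (2 * K) := by
    refine opNorm_le_of_half_net _ ht (by positivity) fun c hc => ?_
    have := opNorm_le_of_half_net (innerSL ℝ (Matrix.toEuclideanLin A c)) hs hK fun d hd => by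
      rw [innerSL_apply_apply, real_inner_comm]
      exact h d hd c hc
    rwa [innerSL_apply_norm] at this
  have h2 := (Matrix.toEuclideanLin A).toContinuousLinearMap.le_opNorm v
  calc |inner ℝ u (Matrix.toEuclideanLin A v)| ≤ ‖u‖ * ‖Matrix.toEuclideanLin A v‖ :=
        abs_real_inner_le_norm _ _
    _ ≤ ‖u‖ * (2 * (2 * K) * ‖v‖) := by
        gcongr
        exact h2.trans (by gcongr)
    _ = _ := by ring

/-! ### Gram matrices and the Gaussian noise -/

/-- The spectral bound says that c₁I − Ψ_t is positive semidefinite; this is its quadratic form at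
u. -/
theorem sum_sq_dotProduct_le {x : Fin T → Fin n → Fin m → ℝ} {c₁ : ℝ} {t : Fin T}
    (h : ∀ μ ∈ spectrum ℝ (taskGram x t), μ ≤ c₁) (u : Fin m → ℝ) :
    ∑ s, (x t s ⬝ᵥ u) ^ 2 ≤ n * c₁ * (u ⬝ᵥ u) := by
  have hH : (taskGram x t).IsHermitian := by
    simp [Matrix.IsHermitian, taskGram, Matrix.transpose_sum, Matrix.transpose_vecMulVec]
  have hps : (algebraMap ℝ (Matrix (Fin m) (Fin m) ℝ) c₁ - taskGram x t).PosSemidef := by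
    rw [Matrix.posSemidef_iff_isHermitian_and_spectrum_nonneg]
    refine ⟨?_, ?_⟩
    · refine Matrix.IsHermitian.sub ?_ hH
      simp [Matrix.IsHermitian, Matrix.algebraMap_eq_diagonal]
    · rw [← spectrum.singleton_sub_eq]
      rintro _ ⟨_, rfl, μ, hμ, rfl⟩
      simpa using h μ hμ
  have h1 := hps.dotProduct_mulVec_nonneg u
  have e : u ⬝ᵥ (taskGram x t).mulVec u = (n : ℝ)⁻¹ * ∑ s, (x t s ⬝ᵥ u) ^ 2 := by
    simp only [taskGram, Matrix.smul_mulVec, Matrix.sum_mulVec, dotProduct_smul, dotProduct_sum,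
      smul_eq_mul, Matrix.vecMulVec_mulVec]
    congr 1
    refine Finset.sum_congr rfl fun s _ => ?_
    rw [dotProduct_comm u]
    simp
    ring
  have h2 : (n : ℝ)⁻¹ * ∑ s, (x t s ⬝ᵥ u) ^ 2 ≤ c₁ * (u ⬝ᵥ u) := by
    rw [← e]
    simp only [star_trivial, Matrix.sub_mulVec, dotProduct_sub, Algebra.algebraMap_eq_smul_one,
      Matrix.smul_mulVec, Matrix.one_mulVec, dotProduct_smul, smul_eq_mul] at h1
    linarith
  rcases Nat.eq_zero_or_pos n with hn | hn
  · subst hn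
    simp
  · have hn' : (0 : ℝ) < n := by exact_mod_cast hn
    rw [inv_mul_le_iff₀ hn'] at h2
    linarith

theorem trace_transpose_taskMask_mul (x : Fin T → Fin n → Fin m → ℝ) (i : Fin T × Fin n)
    (A : Matrix (Fin m) (Fin T) ℝ) :
    ((taskMask x i).transpose * A).trace = x i.1 i.2 ⬝ᵥ A.col i.1 := by
  simp only [Matrix.trace, Matrix.diag, Matrix.mul_apply, Matrix.transpose_apply, taskMask,
    Matrix.updateCol_apply, dotProduct, Matrix.col_apply]
  rw [Finset.sum_eq_single i.1]
  · simp
  · intro j _ hj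
    simp [hj]
  · simp

theorem norm_samplingOp_taskMask_sq_le {x : Fin T → Fin n → Fin m → ℝ} {c₁ : ℝ}
    (h : ∀ t, ∀ μ ∈ spectrum ℝ (taskGram x t), μ ≤ c₁) (A : Matrix (Fin m) (Fin T) ℝ) :
    ‖samplingOp (taskMask x) A‖ ^ 2 ≤ ((T : ℝ) * n)⁻¹ * (n * c₁ * ‖vecL A‖ ^ 2) := by
  rw [norm_samplingOp_sq]
  simp only [Fintype.card_prod, Fintype.card_fin, Nat.cast_mul, trace_transpose_taskMask_mul,
    Fintype.sum_prod_type]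
  gcongr
  have e : ‖vecL A‖ ^ 2 = ∑ t, A.col t ⬝ᵥ A.col t := by
    rw [← real_inner_self_eq_norm_sq, inner_vecL]
    simp [Matrix.trace, Matrix.mul_apply, dotProduct]
  rw [e, Finset.mul_sum]
  exact Finset.sum_le_sum fun t _ => sum_sq_dotProduct_le (h t) _

theorem inner_noiseMatrix_taskMask (x : Fin T → Fin n → Fin m → ℝ) (ξ : Fin T × Fin n → ℝ)
    (u : EuclideanSpace ℝ (Fin m)) (v : EuclideanSpace ℝ (Fin T)) :
    inner ℝ u (Matrix.toEuclideanLin (noiseMatrix (taskMask x) ξ) v)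
      = ∑ i, ((T : ℝ) * n)⁻¹ * ((x i.1 i.2 ⬝ᵥ u.ofLp) * v i.1) * ξ i := by
  rw [← inner_vecL_outer, inner_vecL_noiseMatrix, Finset.mul_sum]
  refine Finset.sum_congr rfl fun i _ => ?_
  have e : x i.1 i.2 ⬝ᵥ (outer u v).col i.1 = (x i.1 i.2 ⬝ᵥ u.ofLp) * v i.1 := by
    simp only [dotProduct, Matrix.col_apply, outer, Matrix.vecMulVec_apply, Finset.sum_mul]
    exact Finset.sum_congr rfl fun j _ => by ring
  rw [trace_transpose_taskMask_mul, e]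
  simp only [Fintype.card_prod, Fintype.card_fin, Nat.cast_mul]
  ring

variable {Ω : Type*} [MeasurableSpace Ω] {P : Measure Ω}

theorem hasSubgaussianMGF_of_hasLaw {X : Ω → ℝ} {v : NNReal} (h : HasLaw X (gaussianReal 0 v) P) :
    HasSubgaussianMGF X v P where
  integrable_exp_mul t := by
    have h1 := integrable_exp_mul_gaussianReal (μ := 0) (v := v) t
    rw [← h.map_eq] at h1
    exact (integrable_map_measure h1.aestronglyMeasurable h.aemeasurable).1 h1
  mgf_le t := by
    rw [mgf_gaussianReal h.map_eq]
    simp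

theorem measureReal_abs_sum_ge_le [IsProbabilityMeasure P] {ι : Type*} [Fintype ι]
    {ξ : ι → Ω → ℝ} {σ : ℝ} (hξ : ∀ i, HasLaw (ξ i) (gaussianReal 0 (Real.toNNReal (σ ^ 2))) P)
    (hind : iIndepFun ξ P) (a : ι → ℝ) {V ε : ℝ} (hV : 0 < V) (hε : 0 ≤ ε)
    (ha : (∑ i, a i ^ 2) * σ ^ 2 ≤ V) :
    P.real {ω | ε ≤ |∑ i, a i * ξ i ω|} ≤ 2 * Real.exp (-ε ^ 2 / (2 * V)) := by
  have hsub := HasSubgaussianMGF.sum_of_iIndepFun (s := Finset.univ)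
    (hind.comp (fun i y => a i * y) fun i => by fun_prop)
    (fun i _ => (hasSubgaussianMGF_of_hasLaw (hξ i)).const_mul (a i))
  have hsubV : HasSubgaussianMGF (fun ω => ∑ i, a i * ξ i ω) (Real.toNNReal V) P := by
    refine ⟨hsub.integrable_exp_mul, fun t => (hsub.mgf_le t).trans ?_⟩
    rw [Real.exp_le_exp, Real.coe_toNNReal _ hV.le]
    gcongr
    rw [NNReal.coe_sum]
    refine le_of_eq_of_le ?_ ha
    rw [Finset.sum_mul]
    refine Finset.sum_congr rfl fun i _ => ?_
    exact congrArg (a i ^ 2 * ·) (Real.coe_toNNReal _ (sq_nonneg σ))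
  have h1 := hsubV.measure_ge_le hε
  have h2 := hsubV.neg.measure_ge_le hε
  rw [Real.coe_toNNReal _ hV.le] at h1 h2
  have hss : {ω | ε ≤ |∑ i, a i * ξ i ω|} ⊆ {ω | ε ≤ ∑ i, a i * ξ i ω}
      ∪ {ω | ε ≤ (-fun ω => ∑ i, a i * ξ i ω) ω} := fun ω hω => by
    simpa [le_abs] using hω
  calc _ ≤ _ := measureReal_mono hss
    _ ≤ _ := measureReal_union_le _ _
    _ ≤ _ := by linarith

/-- The operator norm of the noise matrix is at most `8σ √(c₁(m + T)/(nT²))` with high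
probability. -/
theorem exists_noise_event [IsProbabilityMeasure P] {x : Fin T → Fin n → Fin m → ℝ} {c₁ σ : ℝ}
    (hT : 0 < T) (hn : 0 < n) (hc : 0 < c₁) (hσ : 0 < σ)
    (hspec : ∀ t, ∀ μ ∈ spectrum ℝ (taskGram x t), μ ≤ c₁) {ξ : Fin T × Fin n → Ω → ℝ}
    (hξ : ∀ i, HasLaw (ξ i) (gaussianReal 0 (Real.toNNReal (σ ^ 2))) P)
    (hind : iIndepFun ξ P) :
    ∃ E : Set Ω, MeasurableSet E ∧
      1 - 2 * Real.exp (-((2 - Real.log 5) * ((m : ℝ) + T))) ≤ P.real E ∧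
      ∀ ω ∈ E, ∀ u v, |inner ℝ u (Matrix.toEuclideanLin
          (noiseMatrix (taskMask x) fun i => ξ i ω) v)|
        ≤ 8 * σ * √(c₁ * ((m : ℝ) + T) / ((n : ℝ) * (T : ℝ) ^ 2)) * ‖u‖ * ‖v‖ := by
  obtain ⟨s, hs1, hs2, hs3⟩ := exists_half_net (EuclideanSpace ℝ (Fin m))
  obtain ⟨t, ht1, ht2, ht3⟩ := exists_half_net (EuclideanSpace ℝ (Fin T))
  rw [finrank_euclideanSpace_fin] at hs1 ht1
  have hT' : (0 : ℝ) < T := by exact_mod_cast hT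
  have hn' : (0 : ℝ) < n := by exact_mod_cast hn
  -- K = λ/16: the two nets lose a factor 4, leaving λ/4. With V bounding the variance of u'Mv,
  -- K²/(2V) = 2(m + T), which beats the entropy (m + T) log 5 of the nets.
  set K := 2 * σ * √(c₁ * ((m : ℝ) + T) / ((n : ℝ) * (T : ℝ) ^ 2)) with hK
  set V := σ ^ 2 * c₁ / ((n : ℝ) * (T : ℝ) ^ 2) with hVdef
  have hV : 0 < V := by positivity
  have hK0 : 0 ≤ K := by positivity
  have hKV : -K ^ 2 / (2 * V) = -(2 * ((m : ℝ) + T)) := by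
    rw [hK, mul_pow, Real.sq_sqrt (by positivity), hVdef]
    field_simp
  let bad : EuclideanSpace ℝ (Fin m) × EuclideanSpace ℝ (Fin T) → Set Ω := fun p =>
    {ω | K ≤ |inner ℝ p.1 (Matrix.toEuclideanLin (noiseMatrix (taskMask x) fun i => ξ i ω) p.2)|}
  have hbad (p) (hp : p ∈ s ×ˢ t) : P.real (bad p) ≤ 2 * Real.exp (-(2 * ((m : ℝ) + T))) := by
    obtain ⟨hp1, hp2⟩ := Finset.mem_product.1 hp
    simp only [bad, inner_noiseMatrix_taskMask]
    rw [← hKV]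
    refine measureReal_abs_sum_ge_le hξ hind _ hV hK0 ?_
    have hu : p.1.ofLp ⬝ᵥ p.1.ofLp ≤ 1 := by
      have h1 : p.1.ofLp ⬝ᵥ p.1.ofLp = ‖p.1‖ ^ 2 := by
        rw [EuclideanSpace.real_norm_sq_eq]
        simp [dotProduct, pow_two]
      rw [h1]
      exact pow_le_one₀ (norm_nonneg _) (hs2 _ hp1)
    have hv : ∑ j, p.2 j ^ 2 ≤ 1 := by
      rw [← EuclideanSpace.real_norm_sq_eq]
      exact pow_le_one₀ (norm_nonneg _) (ht2 _ hp2)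
    have h2 : ∑ i : Fin T × Fin n, (((T : ℝ) * n)⁻¹ * ((x i.1 i.2 ⬝ᵥ p.1.ofLp) * p.2 i.1)) ^ 2
        ≤ ((T : ℝ) * n)⁻¹ ^ 2 * (n * c₁) := by
      simp only [mul_pow _ _ 2, ← Finset.mul_sum, Fintype.sum_prod_type, ← Finset.sum_mul]
      gcongr
      calc ∑ j, (∑ k, (x j k ⬝ᵥ p.1.ofLp) ^ 2) * p.2 j ^ 2
          ≤ ∑ j, n * c₁ * p.2 j ^ 2 := by
            gcongr with j _
            refine (sum_sq_dotProduct_le (hspec j) _).trans ?_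
            exact mul_le_of_le_one_right (by positivity) hu
        _ = n * c₁ * ∑ j, p.2 j ^ 2 := by rw [Finset.mul_sum]
        _ ≤ n * c₁ := mul_le_of_le_one_right (by positivity) hv
    calc _ ≤ ((T : ℝ) * n)⁻¹ ^ 2 * (n * c₁) * σ ^ 2 := by gcongr
      _ = V := by
        rw [hVdef]
        field_simp
  set B : Set Ω := ⋃ p ∈ s ×ˢ t, bad p with hB
  have hPB : P.real B ≤ 2 * Real.exp (-((2 - Real.log 5) * ((m : ℝ) + T))) := by
    calc P.real B ≤ ∑ p ∈ s ×ˢ t, P.real (bad p) := measureReal_biUnion_finset_le _ _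
      _ ≤ ∑ p ∈ s ×ˢ t, 2 * Real.exp (-(2 * ((m : ℝ) + T))) := Finset.sum_le_sum hbad
      _ = (s.card * t.card : ℝ) * (2 * Real.exp (-(2 * ((m : ℝ) + T)))) := by
          simp [Finset.card_product]
      _ ≤ ((5 : ℝ) ^ m * 5 ^ T) * (2 * Real.exp (-(2 * ((m : ℝ) + T)))) := by
          gcongr
          · exact_mod_cast hs1
          · exact_mod_cast ht1
      _ = _ := by
          have h5 : ((5 : ℝ) ^ m * 5 ^ T) = Real.exp (Real.log 5 * ((m : ℝ) + T)) := by
            rw [← pow_add, ← Nat.cast_add, mul_comm, Real.exp_nat_mul, Real.exp_log (by norm_num)]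
          rw [h5, mul_left_comm, ← Real.exp_add]
          ring_nf
  -- Passing to a measurable hull of the same measure avoids proving the bad event measurable.
  refine ⟨(toMeasurable P B)ᶜ, (measurableSet_toMeasurable P B).compl, ?_, fun ω hω u v => ?_⟩
  · rw [probReal_compl_eq_one_sub (measurableSet_toMeasurable P B), Measure.real,
      measure_toMeasurable, ← Measure.real]
    linarith
  · have hωB : ω ∉ B := fun h => hω (subset_toMeasurable P B h)
    have := abs_inner_le_of_half_nets (noiseMatrix (taskMask x) fun i => ξ i ω) hs3 ht3 hK0
      (fun u hu v hv => by
        by_contra! hlt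
        exact hωB (Set.mem_biUnion (Finset.mk_mem_product hu hv) hlt.le)) u v
    refine this.trans_eq ?_
    rw [hK]
    ring

/-! ### Interpolation and conclusion -/

/-- With z = y/w, z^q is at most z when z ≤ 1 and at most z² when z ≥ 1. The free scale w keeps the
later bound homogeneous and avoids Hölder's inequality. -/
theorem rpow_le_mul_add {q w y : ℝ} (hq : q ∈ Set.Icc (1 : ℝ) 2) (hw : 0 < w) (hy : 0 ≤ y) :
    y ^ q ≤ w ^ q * (y / w + y ^ 2 / w ^ 2) := by
  have hz : 0 ≤ y / w := by positivity
  have e : y ^ q = w ^ q * (y / w) ^ q := by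
    rw [← Real.mul_rpow hw.le hz, mul_div_cancel₀ _ hw.ne']
  rw [e, ← div_pow]
  gcongr
  rcases le_total (y / w) 1 with h | h
  · rcases hz.eq_or_lt with h0 | h0
    · rw [← h0, Real.zero_rpow (by linarith [hq.1])]
      simp
    · have := Real.rpow_le_rpow_of_exponent_ge h0 h hq.1
      rw [Real.rpow_one] at this
      linarith [sq_nonneg (y / w)]
  · have := Real.rpow_le_rpow_of_exponent_le h hq.2
    rw [Real.rpow_two] at this
    linarith

/-- Interpolation between the nuclear and the Frobenius norm. -/
theorem schattenNorm_rpow_le {m T : ℕ} (A : Matrix (Fin m) (Fin T) ℝ) {q w : ℝ}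
    (hq : q ∈ Set.Icc (1 : ℝ) 2) (hw : 0 < w) :
    schattenNorm q A ^ q ≤ w ^ q * (schattenNorm 1 A / w + ‖vecL A‖ ^ 2 / w ^ 2) := by
  have hq0 : q ≠ 0 := by linarith [hq.1]
  rw [schattenNorm, ← Real.rpow_mul (Finset.sum_nonneg fun i _ =>
    Real.rpow_nonneg (singularValue_nonneg A i) q), one_div_mul_cancel hq0, Real.rpow_one,
    sum_singularValue_rpow A hq0, schattenNorm_one, ← sum_sq_singularValue, Finset.sum_div,
    Finset.sum_div, ← Finset.sum_add_distrib, Finset.mul_sum]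
  exact Finset.sum_le_sum fun i _ => rpow_le_mul_add hq hw (singularValue_nonneg A i)

/-- Positivity of these parameters is not assumed in the theorem. It follows by testing the lower
isometry bound on one matrix unit, whose image under 𝓛 must be nonzero while its squared norm is at
most (Tn)⁻¹nc₁. -/
theorem RestrictedIsometry.gram_bound_pos {m T n k : ℕ} {x : Fin T → Fin n → Fin m → ℝ}
    {c₁ ν δ : ℝ} (hRI : RestrictedIsometry (taskMask x) k ν δ)
    (hspec : ∀ t, ∀ μ ∈ spectrum ℝ (taskGram x t), μ ≤ c₁) :
    0 < T ∧ 0 < n ∧ 0 < c₁ := by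
  have hk := hRI.one_le_order
  have hmin := hRI.order_le
  have hm : 0 < m := by omega
  have hT : 0 < T := by omega
  set A := outer (EuclideanSpace.single (⟨0, hm⟩ : Fin m) (1 : ℝ))
    (EuclideanSpace.single (⟨0, hT⟩ : Fin T) (1 : ℝ))
  have hA : ‖vecL A‖ ^ 2 = 1 := by
    rw [← real_inner_self_eq_norm_sq, inner_vecL_outer_outer]
    simp
  have hpos : 0 < ‖samplingOp (taskMask x) A‖ := by
    have h := hRI.lower A ((rank_outer_le_one _ _).trans hk)
    have h1 : 0 < ‖vecL A‖ := by
      by_contra! h0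
      rw [le_antisymm h0 (norm_nonneg _)] at hA
      norm_num at hA
    rw [schattenNorm_two] at h
    have h2 := (mul_pos (sub_pos.2 hRI.const_lt_one) h1).trans_le h
    exact pos_of_mul_pos_right h2 hRI.scale_pos.le
  have hle := norm_samplingOp_taskMask_sq_le hspec A
  rw [hA, mul_one] at hle
  have hpos2 := (pow_pos hpos 2).trans_le hle
  have hnc : 0 < (n : ℝ) * c₁ := pos_of_mul_pos_right hpos2 (by positivity)
  have hc := pos_of_mul_pos_right hnc (Nat.cast_nonneg n)
  have hn : (0 : ℝ) < n := pos_of_mul_pos_left hnc hc.le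
  exact ⟨hT, by exact_mod_cast hn, hc⟩

end TraceRegression

theorem corollary4 :
    ∃ (δ₀ C₁ : ℝ) (C₂ : ℝ → ℝ), 0 < δ₀ ∧ 0 < C₁ ∧ (∀ q, 0 < C₂ q) ∧
      ∀ (m T n r : ℕ) (x : Fin T → Fin n → Fin m → ℝ) (Astar : Matrix (Fin m) (Fin T) ℝ)
        (σ c₁ ν δ : ℝ) (Ω : Type*) [MeasurableSpace Ω] (P : Measure Ω) [IsProbabilityMeasure P]
        (ξ : Fin T × Fin n → Ω → ℝ),
        0 < σ →
        (∀ i, HasLaw (ξ i) (gaussianReal 0 (Real.toNNReal (σ ^ 2))) P) →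
        iIndepFun ξ P →
        Astar.rank ≤ r →
        (∀ t, ∀ μ ∈ spectrum ℝ (TraceRegression.taskGram x t), μ ≤ c₁) →
        TraceRegression.RestrictedIsometry (TraceRegression.taskMask x) (21 * r) ν δ →
        δ ≤ δ₀ →
        ∃ E : Set Ω, MeasurableSet E ∧
          1 - 2 * Real.exp (-((2 - Real.log 5) * ((m : ℝ) + T))) ≤ P.real E ∧
          ∀ ω ∈ E, ∀ Ahat : Matrix (Fin m) (Fin T) ℝ,
            TraceRegression.IsSchattenEstimator (TraceRegression.taskMask x)
              (TraceRegression.response (TraceRegression.taskMask x) Astar (fun i => ξ i ω))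
              1 (32 * σ * √(c₁ * ((m : ℝ) + T) / ((n : ℝ) * (T : ℝ) ^ 2))) Ahat →
            TraceRegression.predDist (TraceRegression.taskMask x) Ahat Astar ^ 2
                ≤ C₁ * c₁ * σ ^ 2 * r * ν ^ 2 * (((m : ℝ) + T) / ((n : ℝ) * (T : ℝ) ^ 2)) ∧
            ∀ q ∈ Set.Icc (1 : ℝ) 2,
              TraceRegression.schattenNorm q (Ahat - Astar) ^ q
                ≤ C₂ q * c₁ ^ (q / 2) * σ ^ q * r * ν ^ (2 * q)
                  * (((m : ℝ) + T) / ((n : ℝ) * (T : ℝ) ^ 2)) ^ (q / 2) := by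
  -- C₁ = 180000 · 32², and 28800480000 = 480000 + 28800000000 adds the nuclear and Frobenius
  -- constants; the powers of 32 come from λ.
  refine ⟨1 / 100, 184320000, fun q => 28800480000 * 32 ^ q, by norm_num, by norm_num,
    fun q => by positivity, ?_⟩
  intro m T n r x Astar σ c₁ ν δ Ω _ P _ ξ hσ hξ hind hr hspec hRI hδ
  obtain ⟨hT, hn, hc⟩ := hRI.gram_bound_pos hspec
  obtain ⟨E, hE, hPE, hnoise⟩ := TraceRegression.exists_noise_event hT hn hc hσ hspec hξ hind
  have hT' : (0 : ℝ) < T := by exact_mod_cast hT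
  have hn' : (0 : ℝ) < n := by exact_mod_cast hn
  have hν := hRI.scale_pos
  refine ⟨E, hE, hPE, fun ω hω Ahat hAhat => ?_⟩
  set ρ := ((m : ℝ) + T) / ((n : ℝ) * (T : ℝ) ^ 2) with hρ
  have hρ0 : 0 < ρ := by positivity
  have hmul : c₁ * ((m : ℝ) + T) / ((n : ℝ) * (T : ℝ) ^ 2) = c₁ * ρ := by rw [hρ, mul_div_assoc]
  rw [hmul] at hAhat
  set lam := 32 * σ * √(c₁ * ρ) with hlam
  have hlam0 : 0 < lam := by positivity
  obtain ⟨h1, h2, h3⟩ := TraceRegression.estimator_bounds hr hRI hδ hlam0 hAhat fun u v => by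
    have := hnoise ω hω u v
    rw [hmul] at this
    refine this.trans_eq ?_
    rw [hlam]
    ring
  refine ⟨h1.trans_eq ?_, fun q hq => ?_⟩
  · rw [hlam, mul_pow, Real.sq_sqrt (by positivity)]
    ring
  -- The scale w = λν² makes ‖D‖₁/w and ‖D‖₂²/w² both at most a constant times r.
  · have hw : 0 < lam * ν ^ 2 := by positivity
    refine (TraceRegression.schattenNorm_rpow_le (Ahat - Astar) hq hw).trans ?_
    have h2' : TraceRegression.schattenNorm 1 (Ahat - Astar) / (lam * ν ^ 2) ≤ 480000 * r := by
      rw [div_le_iff₀ hw]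
      linarith
    have h3' : ‖TraceRegression.vecL (Ahat - Astar)‖ ^ 2 / (lam * ν ^ 2) ^ 2
        ≤ 28800000000 * r := by
      rw [div_le_iff₀ (by positivity)]
      linarith
    have hpow : (lam * ν ^ 2) ^ q = 32 ^ q * c₁ ^ (q / 2) * σ ^ q * ν ^ (2 * q) * ρ ^ (q / 2) := by
      have hsq : √(c₁ * ρ) ^ q = c₁ ^ (q / 2) * ρ ^ (q / 2) := by
        rw [Real.sqrt_eq_rpow, ← Real.rpow_mul (by positivity), one_div_mul_eq_div,
          Real.mul_rpow hc.le hρ0.le]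
      have hν2 : (ν ^ 2) ^ q = ν ^ (2 * q) := by
        rw [← Real.rpow_two, ← Real.rpow_mul hν.le]
      rw [Real.mul_rpow hlam0.le (by positivity), hlam, Real.mul_rpow (by positivity)
        (by positivity), Real.mul_rpow (by norm_num) hσ.le, hsq, hν2]
      ring
    calc _ ≤ (lam * ν ^ 2) ^ q * (480000 * r + 28800000000 * r) := by gcongr
      _ = _ := by
        rw [hpow]
        ring
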